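/- **Definitions.** Fix real $m>0$ and $\varepsilon>0$ and consider the lattice $\varepsilon\mathbb Z^2\subset\mathbb R^2$. A *checker path* is a finite sequence of lattice points such that the vector from each point (except the last one) to the next one is $(\varepsilon,\varepsilon)$ or $(-\varepsilon,\varepsilon)$. Let $\mathrm{turns}(s)$ be the number of points of $s$ (not the first or the last one) at which the vectors to the next and the previous points are orthogonal. For $(x,t)\in\varepsilon\mathbb Z^2$ with $t>0$ put $$a(x,t,m,\varepsilon)=(1+m^2\varepsilon^2)^{(1-t/\varepsilon)/2}\; i\sum_s(-im\varepsilon)^{\mathrm{turns}(s)},\qquad \tilde a_1(x,t,m,\varepsilon)=\operatorname{Re}a(x,t+\varepsilon,m,\varepsilon),$$ where the sum is over all checker paths $s$ from $(0,0)$ to $(x,t)$ containing $(\varepsilon,\varepsilon)$. For positive integers $w,h$, a *Young diagram of size $w\times h$* is a sequence of positive integers $x_1\le\dots\le x_h=w$; its *number of steps* is the number of distinct integers among $x_1,\dots,x_h$. **Proposition.** 1. Let $m>0$ and $0<\varepsilon\le 1/m$. For every real $v_0<\frac1{\sqrt{1+m^2\varepsilon^2}}$ there is $(x,t)\in\varepsilon\mathbb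 Z^2$ such that $t>0$, $\frac{x+t}{\varepsilon}$ is odd, $$v_0\le\frac xt<\frac1{\sqrt{1+m^2\varepsilon^2}}\qquad\text{and}\qquad \operatorname{sgn}\tilde a_1(x,t,m,\varepsilon)\ne(-1)^{\frac{t-x-\varepsilon}{2\varepsilon}}.$$ 2. Consequently, for such $m,\varepsilon$, the bound $\frac1{\sqrt{1+m^2\varepsilon^2}}$ in the rule "$\operatorname{sgn}\tilde a_1(x,t,m,\varepsilon)=(-1)^{\frac{t-x-\varepsilon}{2\varepsilon}}$ for all $(x,t)\in\varepsilon\mathbb Z^2$ with $t>0$, $\frac{x+t}\varepsilon$ odd and $\frac1{\sqrt{1+m^2\varepsilon^2}}\le\frac xt\le1$" is sharp: the rule becomes false if the bound is replaced by any real $v_0<\frac1{\sqrt{1+m^2\varepsilon^2}}$. 3. The bound $3+2\sqrt2$ in the rule "if $h/w>3+2\sqrt2$, then the number of Young diagrams of size $w\times h$ with an odd number of steps exceeds the number of those with an even number of steps if and only if $w$ is odd" is sharp: for every real $c<3+2\sqrt2$ there are positive integers $w,h$ with $c<h/w<3+2\sqrt2$ for which this equivalence fails. -/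

import Mathlib

/-- The lattice `ε ℤ²`. -/
def checkerLattice (ε : ℝ) : Set (ℝ × ℝ) :=
  {P | ∃ p q : ℤ, P = ((p : ℝ) * ε, (q : ℝ) * ε)}

/-- A checker path: a nonempty finite sequence of points of `ε ℤ²` in which the vector from each
point to the next one is `(ε, ε)` or `(-ε, ε)`. -/
structure IsCheckerPath (ε : ℝ) (s : List (ℝ × ℝ)) : Prop where
  ne_nil : s ≠ []
  mem_lattice : ∀ P ∈ s, P ∈ checkerLattice ε
  step : s.IsChain (fun P Q => Q - P = (ε, ε) ∨ Q - P = (-ε, ε))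

open Classical in
/-- The number of points of `s`, other than the first and the last one, at which the vectors to
the next point and from the previous point are orthogonal. -/
noncomputable def checkerTurns : List (ℝ × ℝ) → ℕ
  | P :: Q :: R :: s =>
      (if (Q - P).1 * (R - Q).1 + (Q - P).2 * (R - Q).2 = 0 then 1 else 0)
        + checkerTurns (Q :: R :: s)
  | _ => 0

/-- The checker paths from `(0, 0)` to `(x, t)` that contain `(ε, ε)`. For `ε > 0` this set is
finite. -/
def checkerPaths (ε x t : ℝ) : Set (List (ℝ × ℝ)) :=
  {s | IsCheckerPath ε s ∧ s.head? = some (0, 0) ∧ s.getLast? = some (x, t) ∧ (ε, ε) ∈ s}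

/-- The wave function `a(x, t, m, ε)` of Feynman checkers, for mass `m` and lattice step `ε`. -/
noncomputable def checkerWave (x t m ε : ℝ) : ℂ :=
  (((1 + m ^ 2 * ε ^ 2) ^ ((1 - t / ε) / 2) : ℝ) : ℂ) * Complex.I *
    ∑ᶠ s ∈ checkerPaths ε x t, (-Complex.I * (m : ℂ) * (ε : ℂ)) ^ checkerTurns s

/-- `ã₁(x, t, m, ε) = Re a(x, t + ε, m, ε)`. -/
noncomputable def checkerWaveRe (x t m ε : ℝ) : ℝ :=
  (checkerWave x (t + ε) m ε).re

/-- A Young diagram of size `w × h`, `h ≥ 1`: positive integers `x₁ ≤ … ≤ x_h = w`. -/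
def IsYoungDiagramOfSize (w h : ℕ) (s : Fin h → ℕ) : Prop :=
  Monotone s ∧ (∀ i, 0 < s i) ∧ ∀ i : Fin h, (i : ℕ) + 1 = h → s i = w

/-- The number of steps: the number of distinct integers among `x₁, …, x_h`. -/
def youngSteps {h : ℕ} (s : Fin h → ℕ) : ℕ :=
  (Finset.univ.image s).card

/-- The number of Young diagrams of size `w × h` with an odd number of steps. -/
noncomputable def youngOddCount (w h : ℕ) : ℕ :=
  {s : Fin h → ℕ | IsYoungDiagramOfSize w h s ∧ Odd (youngSteps s)}.ncard

/-- The number of Young diagrams of size `w × h` with an even number of steps. -/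
noncomputable def youngEvenCount (w h : ℕ) : ℕ :=
  {s : Fin h → ℕ | IsYoungDiagramOfSize w h s ∧ Even (youngSteps s)}.ncard

/-- The sum `∑ₖ C(a, k) C(b, k) zᵏ`, a Meixner polynomial of degree `b` in `a`. -/
def choosePairSum {R : Type*} [CommRing R] (z : R) (a b : ℕ) : R :=
  ∑ k ∈ Finset.range (b + 1), (a.choose k : R) * (b.choose k : R) * z ^ k

/-- The sum `∑ₖ C(a, k + 1) C(b, k) zᵏ`. -/
def choosePairShift {R : Type*} [CommRing R] (z : R) (a b : ℕ) : R :=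
  ∑ k ∈ Finset.range (b + 1), (a.choose (k + 1) : R) * (b.choose k : R) * z ^ k

section ChoosePairSum

variable {R : Type*} [CommRing R] (z : R)

theorem choosePairSum_eq_sum_range (a : ℕ) {b N : ℕ} (h : b < N) :
    choosePairSum z a b = ∑ k ∈ Finset.range N, (a.choose k : R) * (b.choose k : R) * z ^ k := by
  refine Finset.sum_subset (Finset.range_subset_range.2 h) fun k _ hk => ?_
  rw [Nat.choose_eq_zero_of_lt (n := b) (by simpa using hk)]
  simp

theorem choosePairShift_eq_sum_range (a : ℕ) {b N : ℕ} (h : b < N) :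
    choosePairShift z a b
      = ∑ k ∈ Finset.range N, (a.choose (k + 1) : R) * (b.choose k : R) * z ^ k := by
  refine Finset.sum_subset (Finset.range_subset_range.2 h) fun k _ hk => ?_
  rw [Nat.choose_eq_zero_of_lt (n := b) (by simpa using hk)]
  simp

theorem choosePairSum_comm (a b : ℕ) : choosePairSum z a b = choosePairSum z b a := by
  rw [choosePairSum_eq_sum_range z a (show b < a + b + 1 by omega),
    choosePairSum_eq_sum_range z b (show a < a + b + 1 by omega)]
  exact Finset.sum_congr rfl fun k _ => by ring

@[simp] theorem choosePairSum_zero_right (a : ℕ) : choosePairSum z a 0 = 1 := by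
  simp [choosePairSum]

@[simp] theorem choosePairSum_zero_left (b : ℕ) : choosePairSum z 0 b = 1 := by
  rw [choosePairSum_comm, choosePairSum_zero_right]

@[simp] theorem choosePairShift_zero_left (b : ℕ) : choosePairShift z 0 b = 0 := by
  simp [choosePairShift]

theorem choosePairShift_succ_left (a b : ℕ) :
    choosePairShift z (a + 1) b = choosePairShift z a b + choosePairSum z a b := by
  simp only [choosePairShift, choosePairSum, ← Finset.sum_add_distrib]
  refine Finset.sum_congr rfl fun k _ => ?_
  rw [Nat.choose_succ_succ' a k]
  push_cast
  ring

theorem choosePairSum_succ_right (a b : ℕ) :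
    choosePairSum z a (b + 1) = choosePairSum z a b + z * choosePairShift z a b := by
  rw [choosePairSum_eq_sum_range z a (show b < b + 1 + 1 by omega), choosePairSum,
    Finset.sum_range_succ', Finset.sum_range_succ' _ (b + 1), choosePairShift, Finset.mul_sum,
    add_right_comm, ← Finset.sum_add_distrib]
  congr 1
  swap
  · simp
  refine Finset.sum_congr rfl fun k _ => ?_
  rw [Nat.choose_succ_succ' b k]
  push_cast
  ring

theorem choosePairSum_succ_left (a b : ℕ) :
    choosePairSum z (a + 1) b = choosePairSum z a b + z * choosePairShift z b a := by
  rw [choosePairSum_comm, choosePairSum_succ_right, choosePairSum_comm]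

theorem choosePairShift_eq_sum (a b : ℕ) :
    choosePairShift z b a = ∑ j ∈ Finset.range b, choosePairSum z a j := by
  induction b with
  | zero => simp
  | succ b ih => rw [choosePairShift_succ_left, Finset.sum_range_succ, ih, choosePairSum_comm]

theorem mul_choosePairShift (a b : ℕ) :
    z * ((b + 1) * choosePairShift z a b)
      = ∑ k ∈ Finset.range (b + 2), k * ((a.choose k : R) * ((b + 1).choose k : R) * z ^ k) := by
  rw [Finset.sum_range_succ', choosePairShift]
  simp only [Finset.mul_sum, Nat.cast_zero, zero_mul, add_zero]
  refine Finset.sum_congr rfl fun k _ => ?_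
  have h : ((b : R) + 1) * (b.choose k : R) = ((b + 1).choose (k + 1) : R) * (k + 1) := by
    exact_mod_cast congrArg (Nat.cast (R := R)) (Nat.add_one_mul_choose_eq b k)
  push_cast
  linear_combination (z * (a.choose (k + 1) : R) * z ^ k) * h

theorem choosePairShift_relation (a b : ℕ) :
    (b + 2) * choosePairShift z a (b + 1)
      = (1 - z) * ((b + 1) * choosePairShift z a b) + a * choosePairSum z a (b + 1) := by
  have h0 := mul_choosePairShift z a b
  rw [sub_mul, one_mul, h0, choosePairShift_eq_sum_range z a (show b < b + 2 by omega),
    choosePairShift, choosePairSum]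
  simp only [Finset.mul_sum, ← Finset.sum_sub_distrib, ← Finset.sum_add_distrib]
  refine Finset.sum_congr rfl fun k hk => ?_
  have hk' : k ≤ b + 1 := by simpa [Nat.lt_succ_iff] using hk
  have h1 : (b.choose k : R) * (b + 1) = ((b + 1).choose k : R) * (b + 1 - k) := by
    have := congrArg (Nat.cast (R := R)) (Nat.choose_mul_succ_eq b k)
    push_cast [Nat.cast_sub hk'] at this
    exact this
  have h2 : (a.choose (k + 1) : R) * (k + 1) = (a.choose k : R) * (a - k) := by
    rcases le_or_gt k a with h | h
    · have := congrArg (Nat.cast (R := R)) (Nat.choose_succ_right_eq a k)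
      push_cast [Nat.cast_sub h] at this
      exact this
    · rw [Nat.choose_eq_zero_of_lt h, Nat.choose_eq_zero_of_lt (show a < k + 1 by omega)]
      simp
  linear_combination (-(a.choose (k + 1) : R) * z ^ k) * h1 + ((b + 1).choose k : R) * z ^ k * h2

/-- The three-term recurrence of the Meixner polynomials. -/
theorem choosePairSum_recurrence (a b : ℕ) :
    (b + 2) * choosePairSum z a (b + 2) + (1 - z) * (b + 1) * choosePairSum z a b
      = ((1 - z) * (b + 1) + (b + 2) + z * a) * choosePairSum z a (b + 1) := by
  have h1 := choosePairSum_succ_right z a (b + 1)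
  have h2 := choosePairSum_succ_right z a b
  have h3 := choosePairShift_relation z a b
  linear_combination (b + 2) * h1 - (1 - z) * (b + 1) * h2 + z * h3

end ChoosePairSum

theorem ofReal_choosePairSum (z : ℝ) (a b : ℕ) :
    ((choosePairSum z a b : ℝ) : ℂ) = choosePairSum (z : ℂ) a b := by
  simp [choosePairSum]

theorem ofReal_choosePairShift (z : ℝ) (a b : ℕ) :
    ((choosePairShift z a b : ℝ) : ℂ) = choosePairShift (z : ℂ) a b := by
  simp [choosePairShift]

/-- A sequence with `U (j + 2) + U j ≤ (2 - δ) U (j + 1)` does not stay positive for long. -/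
theorem not_forall_pos_of_oscillating {U : ℕ → ℝ} {δ : ℝ} {L : ℕ} (hδ : 0 < δ)
    (hL : 2 ≤ (L + 1) * δ) (hpos : ∀ j ≤ L + 2, 0 < U j)
    (hrec : ∀ j ≤ L, U (j + 2) + U j ≤ (2 - δ) * U (j + 1)) : False := by
  have key : ∀ j ≤ L, U (j + 2) ≤ (2 - (j + 1) * δ) * U (j + 1) := by
    intro j
    induction j with
    | zero =>
      intro h
      have h1 := hrec 0 h
      have h2 := hpos 0 (by omega)
      simp only [zero_add, Nat.cast_zero, one_mul] at *
      linarith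
    | succ j ih =>
      intro h
      have h1 := ih (by omega)
      have h2 := hrec (j + 1) h
      have p1 := hpos (j + 1) (by omega)
      have p2 := hpos (j + 2) (by omega)
      set r := 2 - ((j : ℝ) + 1) * δ with hr
      have hr0 : 0 < r := by
        by_contra! hneg
        nlinarith
      have h3 : (2 - r) * U (j + 2) ≤ U (j + 1) := by
        by_cases hr2 : 2 - r ≤ 0
        · nlinarith
        · nlinarith [mul_le_mul_of_nonneg_left h1 (not_le.1 hr2).le,
            mul_nonneg (sq_nonneg (r - 1)) p1.le]
      push_cast
      have e1 : j + 1 + 2 = j + 3 := rfl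
      have e2 : j + 1 + 1 = j + 2 := rfl
      rw [e1, e2] at *
      nlinarith
  have h := key L le_rfl
  have p1 := hpos (L + 1) (by omega)
  have p2 := hpos (L + 2) (by omega)
  nlinarith

theorem signed_choosePairSum_recurrence (κ : ℝ) (a b : ℕ) :
    (b + 2) * ((-1) ^ (b + 2) * choosePairSum (1 - κ ^ 2) a (b + 2))
        + κ ^ 2 * (b + 1) * ((-1) ^ b * choosePairSum (1 - κ ^ 2) a b)
      = ((κ ^ 2 - 1) * a - κ ^ 2 * (b + 1) - (b + 2))
        * ((-1) ^ (b + 1) * choosePairSum (1 - κ ^ 2) a (b + 1)) := by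
  have h := choosePairSum_recurrence (1 - κ ^ 2) a b
  linear_combination (-1) ^ b * h

/-- Sign failures of `(-1)ᵇ ∑ₖ C(a, k) C(b, k) (1 - κ²)ᵏ` with `a / b` arbitrarily close to, and
below, `(κ + 1) / (κ - 1)`. -/
theorem exists_sign_failure {κ l : ℝ} (hκ : 1 < κ) (hl : l < (κ + 1) / (κ - 1)) :
    ∃ a b : ℕ, l * (b + 1) < a ∧ a * (κ - 1) ≤ (κ + 1) * b ∧
      ¬ (0 ≤ (-1) ^ b * choosePairSum (1 - κ ^ 2) a b ∧
        (Even b → 0 < (-1) ^ b * choosePairSum (1 - κ ^ 2) a b)) := by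
  by_contra! hcon
  have hκ1 : 0 < κ - 1 := sub_pos.2 hκ
  have hstar : 0 < (κ + 1) / (κ - 1) := by positivity
  obtain ⟨l₀, hl₀, hl₀'⟩ := exists_between (max_lt hl hstar)
  obtain ⟨μ, hμ, hμ'⟩ := exists_between hl₀'
  have hl₀pos : 0 < l₀ := (le_max_right _ _).trans_lt hl₀
  have hll₀ : l < l₀ := (le_max_left _ _).trans_lt hl₀
  have hμ1 : μ * (κ - 1) < κ + 1 := (lt_div_iff₀ hκ1).1 hμ'
  have hκ0 : 0 < κ := by linarith
  obtain ⟨δ, hδ⟩ : ∃ δ : ℝ, δ * κ = (κ + 1) * (κ + 1 - μ * (κ - 1)) :=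
    ⟨(κ + 1) * (κ + 1 - μ * (κ - 1)) / κ, by field_simp⟩
  have hδ0 : 0 < δ := by
    refine pos_of_mul_pos_left ?_ hκ0.le
    rw [hδ]
    exact mul_pos (by linarith) (by linarith)
  obtain ⟨L, hL⟩ := exists_nat_gt (2 / δ)
  have hL2 : 2 ≤ (L + 1) * δ := by
    have := (div_lt_iff₀ hδ0).1 hL
    linarith
  obtain ⟨n, hn⟩ := exists_nat_gt ((l₀ * (L + 5) + 1) / (μ - l₀))
  have hn1 := (div_lt_iff₀ (sub_pos.2 hμ)).1 hn
  obtain ⟨a, ha⟩ : ∃ a : ℕ, a = ⌊μ * n⌋₊ := ⟨_, rfl⟩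
  have hμ0 : 0 < μ := hl₀pos.trans hμ
  have ha1 : (a : ℝ) ≤ μ * n := ha ▸ Nat.floor_le (by positivity)
  have ha2 : μ * n < a + 1 := ha ▸ Nat.lt_floor_add_one _
  have hwin : ∀ j ≤ L + 4, l * (((n + j : ℕ) : ℝ) + 1) < a ∧
      a * (κ - 1) ≤ (κ + 1) * ((n + j : ℕ) : ℝ) := by
    intro j hj
    have hj' : (j : ℝ) ≤ L + 4 := by exact_mod_cast hj
    have hj0 : (0 : ℝ) ≤ j := j.cast_nonneg
    have hn0 : (0 : ℝ) ≤ n := n.cast_nonneg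
    push_cast
    constructor
    · have h1 : l * ((n : ℝ) + j + 1) ≤ l₀ * (n + j + 1) :=
        mul_le_mul_of_nonneg_right hll₀.le (by positivity)
      have h2 : l₀ * ((n : ℝ) + j + 1) ≤ l₀ * (n + (L + 4) + 1) :=
        mul_le_mul_of_nonneg_left (by linarith) hl₀pos.le
      nlinarith
    · have h1 := mul_le_mul_of_nonneg_right ha1 hκ1.le
      have h2 := mul_le_mul_of_nonneg_right hμ1.le hn0
      nlinarith
  obtain ⟨T, hT⟩ : ∃ T : ℕ → ℝ, ∀ b, T b = (-1) ^ b * choosePairSum (1 - κ ^ 2) a b :=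
    ⟨_, fun _ => rfl⟩
  have hT0 : ∀ j ≤ L + 4, 0 ≤ T (n + j) := fun j hj =>
    hT (n + j) ▸ (hcon a _ (hwin j hj).1 (hwin j hj).2).1
  have hTe : ∀ j ≤ L + 4, Even (n + j) → 0 < T (n + j) := fun j hj =>
    hT (n + j) ▸ (hcon a _ (hwin j hj).1 (hwin j hj).2).2
  have hrec : ∀ b : ℕ, ((b : ℝ) + 2) * T (b + 2) + κ ^ 2 * (b + 1) * T b
      = ((κ ^ 2 - 1) * a - κ ^ 2 * (b + 1) - (b + 2)) * T (b + 1) := fun b => by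
    simpa only [hT] using signed_choosePairSum_recurrence κ a b
  have hTpos : ∀ j ≤ L + 2, 0 < T (n + 1 + j) := by
    intro j hj
    rw [show n + 1 + j = n + (j + 1) by omega]
    by_cases he : Even (n + (j + 1))
    · exact hTe _ (by omega) he
    · refine lt_of_le_of_ne (hT0 _ (by omega)) fun h0 => ?_
      have h1 : 0 < T (n + j) := hTe _ (by omega) (by
        rw [← add_assoc, Nat.even_add_one, not_not] at he
        exact he)
      have h2 := hrec (n + j)
      have h3 : 0 ≤ T (n + j + 2) := hT0 (j + 2) (by omega)
      rw [show n + j + 1 = n + (j + 1) by omega, ← h0, mul_zero] at h2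
      have h4 : 0 < κ ^ 2 * (((n + j : ℕ) : ℝ) + 1) * T (n + j) := by positivity
      have h5 : 0 ≤ (((n + j : ℕ) : ℝ) + 2) * T (n + j + 2) := by positivity
      linarith
  refine not_forall_pos_of_oscillating (U := fun j => T (n + 1 + j) / κ ^ j) hδ0 hL2
    (fun j hj => div_pos (hTpos j hj) (by positivity)) fun j hj => ?_
  have h1 := hrec (n + 1 + j)
  have p0 := hTpos j (by omega)
  have p1 : 0 < T (n + 1 + j + 1) := hTpos (j + 1) (by omega)
  have p2 : 0 < T (n + 1 + j + 2) := hTpos (j + 2) (by omega)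
  push_cast at h1
  have hj0 : (0 : ℝ) ≤ j := j.cast_nonneg
  have hn0 : (0 : ℝ) ≤ n := n.cast_nonneg
  set β : ℝ := (n : ℝ) + 1 + j + 1 with hβ
  have hβ0 : 0 < β := by positivity
  have hK : (κ ^ 2 - 1) * a - κ ^ 2 * β - (β + 1) ≤ (2 - δ) * κ * β := by
    have e1 : (κ ^ 2 - 1) * a ≤ (κ ^ 2 - 1) * (μ * n) :=
      mul_le_mul_of_nonneg_left ha1 (by nlinarith)
    have e2 : (κ ^ 2 - 1) * μ * n ≤ (κ ^ 2 - 1) * μ * β :=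
      mul_le_mul_of_nonneg_left (by linarith) (mul_nonneg (by nlinarith) hμ0.le)
    have e3 : (2 - δ) * κ * β = 2 * κ * β - (κ + 1) * (κ + 1 - μ * (κ - 1)) * β := by
      rw [← hδ]; ring
    rw [e3]
    linarith
  have hmain : T (n + 1 + j + 2) + κ ^ 2 * T (n + 1 + j)
      ≤ (2 - δ) * κ * T (n + 1 + j + 1) := by
    refine le_of_mul_le_mul_left ?_ hβ0
    have e1 := mul_le_mul_of_nonneg_right hK p1.le
    have e2 : ((n : ℝ) + 1 + j + 2) = β + 1 := by rw [hβ]; ring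
    rw [e2] at h1
    linarith
  have e : ∀ x : ℝ, x / κ ^ j = κ ^ 2 * x / κ ^ (j + 2) := fun x => by
    rw [div_eq_div_iff (by positivity) (by positivity)]
    ring
  have e' : ∀ x : ℝ, x / κ ^ (j + 1) = κ * x / κ ^ (j + 2) := fun x => by
    rw [div_eq_div_iff (by positivity) (by positivity)]
    ring
  change T (n + 1 + j + 2) / κ ^ (j + 2) + T (n + 1 + j) / κ ^ j
    ≤ (2 - δ) * (T (n + 1 + j + 1) / κ ^ (j + 1))
  rw [e, e', ← add_div, ← mul_div_assoc]
  refine div_le_div_of_nonneg_right ?_ (by positivity)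
  linarith

/-- The horizontal direction of a step of a checker path: `1` or `-1`. -/
def stepDir (b : Bool) : ℤ := if b then 1 else -1

/-- The lattice path with step `ε` from `(p ε, q ε)` whose steps are encoded by a list. -/
def pathOfSteps (ε : ℝ) : ℤ → ℤ → List Bool → List (ℝ × ℝ)
  | p, q, [] => [((p : ℝ) * ε, (q : ℝ) * ε)]
  | p, q, b :: l => ((p : ℝ) * ε, (q : ℝ) * ε) :: pathOfSteps ε (p + stepDir b) (q + 1) l

/-- The number of changes of direction in a list of steps that is preceded by a step `d`. -/
def stepChanges : Bool → List Bool → ℕ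
  | _, [] => 0
  | d, b :: l => (if d = b then 0 else 1) + stepChanges b l

/-- Lists of steps with `a` steps to the right and `b` steps to the left. -/
def stepLists (a b : ℕ) : Set (List Bool) :=
  {l | l.count true = a ∧ l.count false = b}

section Paths

variable {ε : ℝ}

theorem pathOfSteps_ne_nil (p q : ℤ) (l : List Bool) : pathOfSteps ε p q l ≠ [] := by
  cases l <;> simp [pathOfSteps]

theorem head?_pathOfSteps (p q : ℤ) (l : List Bool) :
    (pathOfSteps ε p q l).head? = some ((p : ℝ) * ε, (q : ℝ) * ε) := by
  cases l <;> simp [pathOfSteps]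

theorem pathOfSteps_eq_cons (p q : ℤ) (l : List Bool) :
    ∃ s, pathOfSteps ε p q l = ((p : ℝ) * ε, (q : ℝ) * ε) :: s := by
  cases l <;> simp [pathOfSteps]

theorem getLast?_pathOfSteps (p q : ℤ) (l : List Bool) :
    (pathOfSteps ε p q l).getLast? =
      some (((p + l.count true - l.count false : ℤ) : ℝ) * ε,
        ((q + l.count true + l.count false : ℤ) : ℝ) * ε) := by
  induction l generalizing p q with
  | nil => simp [pathOfSteps]
  | cons b l ih =>
    obtain ⟨s, hs⟩ := pathOfSteps_eq_cons (ε := ε) (p + stepDir b) (q + 1) l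
    rw [pathOfSteps, hs, List.getLast?_cons_cons, ← hs, ih]
    cases b
    · simp [stepDir]; constructor <;> left <;> ring
    · simp [stepDir]; constructor <;> left <;> ring

theorem isCheckerPath_pathOfSteps (p q : ℤ) (l : List Bool) :
    IsCheckerPath ε (pathOfSteps ε p q l) := by
  refine ⟨pathOfSteps_ne_nil p q l, ?_, ?_⟩
  · induction l generalizing p q with
    | nil => simpa [pathOfSteps] using ⟨p, q, rfl⟩
    | cons b l ih =>
      intro P hP
      rcases List.mem_cons.1 hP with rfl | hP
      · exact ⟨p, q, rfl⟩
      · exact ih _ _ P hP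
  · induction l generalizing p q with
    | nil => simp [pathOfSteps]
    | cons b l ih =>
      have h := ih (p + stepDir b) (q + 1)
      obtain ⟨s, hs⟩ := pathOfSteps_eq_cons (ε := ε) (p + stepDir b) (q + 1) l
      rw [pathOfSteps]
      rw [hs] at h ⊢
      refine List.isChain_cons_cons.2 ⟨?_, h⟩
      cases b
      · right; simp [stepDir]; constructor <;> ring
      · left; simp [stepDir]; constructor <;> ring

theorem exists_pathOfSteps {s : List (ℝ × ℝ)} {p q : ℤ}
    (hs : s.IsChain (fun P Q => Q - P = (ε, ε) ∨ Q - P = (-ε, ε)))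
    (h0 : s.head? = some ((p : ℝ) * ε, (q : ℝ) * ε)) : ∃ l, s = pathOfSteps ε p q l := by
  induction s generalizing p q with
  | nil => simp at h0
  | cons P s ih =>
    obtain rfl : P = ((p : ℝ) * ε, (q : ℝ) * ε) := by simpa using h0
    cases s with
    | nil => exact ⟨[], rfl⟩
    | cons Q s =>
      obtain ⟨h1, h2⟩ := List.isChain_cons_cons.1 hs
      have step : ∀ b : Bool, Q = (((p + stepDir b : ℤ) : ℝ) * ε, ((q + 1 : ℤ) : ℝ) * ε) →
          ∃ l, ((p : ℝ) * ε, (q : ℝ) * ε) :: Q :: s = pathOfSteps ε p q l := by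
        intro b hb
        obtain ⟨l, hl⟩ := ih (p := p + stepDir b) (q := q + 1) h2 (by simp [hb])
        exact ⟨b :: l, by rw [pathOfSteps, hl]⟩
      rcases h1 with h1 | h1
      · refine step true ?_
        rw [sub_eq_iff_eq_add.1 h1]
        simp [stepDir]; constructor <;> ring
      · refine step false ?_
        rw [sub_eq_iff_eq_add.1 h1]
        simp [stepDir]; constructor <;> ring

theorem pathOfSteps_injective (hε : 0 < ε) (p q : ℤ) :
    Function.Injective (pathOfSteps ε p q) := by
  intro l
  induction l generalizing p q with
  | nil =>
    intro l' h
    cases l' with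
    | nil => rfl
    | cons b l' => simpa [pathOfSteps, pathOfSteps_ne_nil] using h.symm
  | cons b l ih =>
    intro l' h
    cases l' with
    | nil => simp [pathOfSteps, pathOfSteps_ne_nil] at h
    | cons b' l' =>
      have h1 : pathOfSteps ε (p + stepDir b) (q + 1) l
          = pathOfSteps ε (p + stepDir b') (q + 1) l' := (List.cons.inj h).2
      have h2 := congrArg List.head? h1
      rw [head?_pathOfSteps, head?_pathOfSteps] at h2
      have hb : b = b' := by
        cases b <;> cases b' <;> simp [stepDir, hε.ne'] at h2 ⊢ <;> linarith
      subst hb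
      rw [ih _ _ h1]

theorem le_snd_of_mem_pathOfSteps (hε : 0 < ε) {p q : ℤ} {l : List Bool} {P : ℝ × ℝ}
    (hP : P ∈ pathOfSteps ε p q l) : (q : ℝ) * ε ≤ P.2 := by
  induction l generalizing p q with
  | nil =>
    obtain rfl : P = _ := by simpa [pathOfSteps] using hP
    exact le_rfl
  | cons b l ih =>
    rcases List.mem_cons.1 hP with rfl | hP
    · exact le_rfl
    · have := ih hP
      push_cast at this
      linarith

theorem mem_pathOfSteps_iff (hε : 0 < ε) (l : List Bool) :
    (ε, ε) ∈ pathOfSteps ε 0 0 l ↔ ∃ l', l = true :: l' := by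
  constructor
  · intro h
    cases l with
    | nil => simp [pathOfSteps, hε.ne'] at h
    | cons b l =>
      have h1 : (ε, ε) ∈ pathOfSteps ε (0 + stepDir b) (0 + 1) l := by
        simpa [pathOfSteps, hε.ne'] using h
      cases b with
      | true => exact ⟨l, rfl⟩
      | false =>
        exfalso
        have hne : ε ≠ -ε := by linarith
        cases l with
        | nil => simp [pathOfSteps, stepDir, hne] at h1
        | cons c l =>
          have h2 : (ε, ε) ∈ pathOfSteps ε (0 + stepDir false + stepDir c) (0 + 1 + 1) l := by
            simpa [pathOfSteps, stepDir, hne] using h1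
          have := le_snd_of_mem_pathOfSteps hε h2
          norm_num at this
          linarith
  · rintro ⟨l', rfl⟩
    obtain ⟨s, hs⟩ := pathOfSteps_eq_cons (ε := ε) (0 + stepDir true) (0 + 1) l'
    rw [pathOfSteps, hs]
    simp [stepDir]

theorem checkerTurns_pathOfSteps (hε : 0 < ε) (p q : ℤ) (d : Bool) (l : List Bool) :
    checkerTurns (pathOfSteps ε p q (d :: l)) = stepChanges d l := by
  induction l generalizing p q d with
  | nil => simp [pathOfSteps, checkerTurns, stepChanges]
  | cons b l ih =>
    have h := ih (p + stepDir d) (q + 1) b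
    obtain ⟨s, hs⟩ := pathOfSteps_eq_cons (ε := ε) (p + stepDir d + stepDir b) (q + 1 + 1) l
    rw [pathOfSteps, hs] at h
    rw [pathOfSteps, pathOfSteps, hs, checkerTurns, h, stepChanges]
    have hpos : 0 < ε * ε := mul_pos hε hε
    congr 1
    cases d <;> cases b <;> simp [stepDir]
    all_goals ring_nf
    all_goals nlinarith

/-- The checker paths ending at a lattice point, in terms of their steps after the first one. -/
theorem checkerPaths_eq_image (hε : 0 < ε) (a b : ℕ) :
    checkerPaths ε (((a : ℝ) - b) * ε) (((a : ℝ) + b + 1) * ε + ε)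
      = (fun l => pathOfSteps ε 0 0 (true :: l)) '' stepLists a (b + 1) := by
  have hlast : ∀ l : List Bool, (pathOfSteps ε 0 0 (true :: l)).getLast?
      = some (((a : ℝ) - b) * ε, ((a : ℝ) + b + 1) * ε + ε) ↔ l ∈ stepLists a (b + 1) := by
    intro l
    rw [getLast?_pathOfSteps, Option.some_inj, Prod.mk.injEq,
      show ((a : ℝ) - b) * ε = ((a - b : ℤ) : ℝ) * ε by push_cast; ring,
      show ((a : ℝ) + b + 1) * ε + ε = ((a + b + 2 : ℤ) : ℝ) * ε by push_cast; ring,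
      mul_left_inj' hε.ne', mul_left_inj' hε.ne', Int.cast_inj, Int.cast_inj]
    simp only [List.count_cons, stepLists, Set.mem_ofPred_eq]
    simp
    omega
  ext s
  constructor
  · rintro ⟨h1, h2, h3, h4⟩
    obtain ⟨l, rfl⟩ := exists_pathOfSteps (p := 0) (q := 0) h1.step (by simpa using h2)
    obtain ⟨l', rfl⟩ := (mem_pathOfSteps_iff hε l).1 h4
    exact ⟨l', (hlast l').1 h3, rfl⟩
  · rintro ⟨l, hl, rfl⟩
    exact ⟨isCheckerPath_pathOfSteps _ _ _, by simp [head?_pathOfSteps], (hlast l).2 hl,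
      (mem_pathOfSteps_iff hε _).2 ⟨l, rfl⟩⟩

end Paths

section StepLists

theorem stepLists_zero_zero : stepLists 0 0 = {[]} := by
  ext l
  cases l with
  | nil => simp [stepLists]
  | cons b l => cases b <;> simp [stepLists]

theorem stepLists_succ_zero (a : ℕ) : stepLists (a + 1) 0 = List.cons true '' stepLists a 0 := by
  ext l
  cases l with
  | nil => simp [stepLists]
  | cons b l => cases b <;> simp [stepLists]

theorem stepLists_zero_succ (b : ℕ) : stepLists 0 (b + 1) = List.cons false '' stepLists 0 b := by
  ext l
  cases l with
  | nil => simp [stepLists]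
  | cons b l => cases b <;> simp [stepLists]

theorem stepLists_succ_succ (a b : ℕ) : stepLists (a + 1) (b + 1)
    = List.cons true '' stepLists a (b + 1) ∪ List.cons false '' stepLists (a + 1) b := by
  ext l
  cases l with
  | nil => simp [stepLists]
  | cons b l => cases b <;> simp [stepLists]

theorem finite_stepLists (a b : ℕ) : (stepLists a b).Finite := by
  induction a generalizing b with
  | zero =>
    induction b with
    | zero => simp [stepLists_zero_zero]
    | succ b ih => rw [stepLists_zero_succ]; exact ih.image _
  | succ a iha =>
    induction b with
    | zero => rw [stepLists_succ_zero]; exact (iha 0).image _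
    | succ b ih => rw [stepLists_succ_succ]; exact ((iha _).image _).union (ih.image _)

variable {R : Type*} [CommRing R]

/-- The generating function of direction changes. -/
noncomputable def changeSum (y : R) (d : Bool) (a b : ℕ) : R :=
  ∑ᶠ l ∈ stepLists a b, y ^ stepChanges d l

theorem finsum_cons_image (y : R) (d c : Bool) (a b : ℕ) :
    ∑ᶠ l ∈ List.cons c '' stepLists a b, y ^ stepChanges d l
      = y ^ (if d = c then 0 else 1) * changeSum y c a b := by
  rw [finsum_mem_image List.cons_injective.injOn, changeSum, ← smul_eq_mul,
    smul_finsum_mem (finite_stepLists a b)]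
  simp only [stepChanges, pow_add, smul_eq_mul]

theorem changeSum_zero_zero (y : R) (d : Bool) : changeSum y d 0 0 = 1 := by
  simp [changeSum, stepLists_zero_zero, stepChanges]

theorem changeSum_true_zero (y : R) (a : ℕ) : changeSum y true a 0 = 1 := by
  induction a with
  | zero => exact changeSum_zero_zero y true
  | succ a ih => rw [changeSum, stepLists_succ_zero, finsum_cons_image, ih]; simp

theorem changeSum_false_zero (y : R) (b : ℕ) : changeSum y false 0 b = 1 := by
  induction b with
  | zero => exact changeSum_zero_zero y false
  | succ a ih => rw [changeSum, stepLists_zero_succ, finsum_cons_image, ih]; simp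

theorem changeSum_succ_succ (y : R) (d : Bool) (a b : ℕ) :
    changeSum y d (a + 1) (b + 1) = y ^ (if d = true then 0 else 1) * changeSum y true a (b + 1)
      + y ^ (if d = false then 0 else 1) * changeSum y false (a + 1) b := by
  rw [changeSum, stepLists_succ_succ, finsum_mem_union, finsum_cons_image, finsum_cons_image]
  · rw [Set.disjoint_left]
    rintro _ ⟨l, _, rfl⟩ ⟨l', _, h⟩
    simp at h
  · exact (finite_stepLists _ _).image _
  · exact (finite_stepLists _ _).image _

theorem changeSum_eq (y : R) (a b : ℕ) :
    changeSum y true a (b + 1)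
        = y * choosePairSum (y ^ 2) a b + y ^ 2 * choosePairShift (y ^ 2) a b ∧
      changeSum y false (b + 1) a
        = y * choosePairSum (y ^ 2) a b + y ^ 2 * choosePairShift (y ^ 2) a b := by
  induction hn : a + b using Nat.strong_induction_on generalizing a b with
  | _ n ih =>
    cases a with
    | zero =>
      constructor
      · rw [changeSum, stepLists_zero_succ, finsum_cons_image, changeSum_false_zero]
        simp
      · rw [changeSum, stepLists_succ_zero, finsum_cons_image, changeSum_true_zero]
        simp
    | succ a =>
      have h1 := ih (a + b) (by omega) a b rfl
      have h2 := ih (b + a) (by omega) b a rfl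
      rw [changeSum_succ_succ, changeSum_succ_succ, h1.1, h1.2, h2.1, h2.2,
        choosePairSum_succ_left, choosePairShift_succ_left, choosePairSum_comm _ b a]
      constructor <;> simp <;> ring

end StepLists

/-- The real part of the wave function as a Meixner polynomial. -/
theorem checkerWaveRe_eq {m ε : ℝ} (hε : 0 < ε) (a b : ℕ) :
    checkerWaveRe (((a : ℝ) - b) * ε) (((a : ℝ) + b + 1) * ε) m ε
      = (1 + m ^ 2 * ε ^ 2) ^ ((1 - (((a : ℝ) + b + 1) * ε + ε) / ε) / 2)
        * (m * ε * choosePairSum (-(m * ε) ^ 2) a b) := by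
  have hsum : ∑ᶠ s ∈ checkerPaths ε (((a : ℝ) - b) * ε) (((a : ℝ) + b + 1) * ε + ε),
        (-Complex.I * (m : ℂ) * (ε : ℂ)) ^ checkerTurns s
      = changeSum (-Complex.I * (m : ℂ) * (ε : ℂ)) true a (b + 1) := by
    have hinj : Function.Injective fun l => pathOfSteps ε 0 0 (true :: l) :=
      (pathOfSteps_injective hε 0 0).comp List.cons_injective
    rw [checkerPaths_eq_image hε, finsum_mem_image hinj.injOn, changeSum]
    simp only [checkerTurns_pathOfSteps hε]
  have hy : (-Complex.I * (m : ℂ) * (ε : ℂ)) ^ 2 = ((-(m * ε) ^ 2 : ℝ) : ℂ) := by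
    push_cast
    linear_combination ((m : ℂ) ^ 2 * (ε : ℂ) ^ 2) * Complex.I_sq
  rw [checkerWaveRe, checkerWave, hsum, (changeSum_eq _ a b).1, hy, ← ofReal_choosePairSum,
    ← ofReal_choosePairShift, mul_assoc, Complex.re_ofReal_mul]
  generalize -(m * ε) ^ 2 = z
  simp

/-- The sign rule for `ã₁` fails arbitrarily close below `1 / √(1 + m² ε²)`. -/
theorem exists_checkerWaveRe_sign_failure {m ε : ℝ} (hm : 0 < m) (hε : 0 < ε) {v₀ : ℝ}
    (hv : v₀ < 1 / Real.sqrt (1 + m ^ 2 * ε ^ 2)) :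
    ∃ p q : ℤ, 0 < (q : ℝ) * ε ∧ Odd (p + q) ∧
      v₀ ≤ ((p : ℝ) * ε) / ((q : ℝ) * ε) ∧
      ((p : ℝ) * ε) / ((q : ℝ) * ε) < 1 / Real.sqrt (1 + m ^ 2 * ε ^ 2) ∧
      Real.sign (checkerWaveRe ((p : ℝ) * ε) ((q : ℝ) * ε) m ε)
        ≠ (-1 : ℝ) ^ ((q - p - 1) / 2) := by
  have hu : 0 < m ^ 2 * ε ^ 2 := by positivity
  obtain ⟨κ, hκdef⟩ : ∃ κ, κ = Real.sqrt (1 + m ^ 2 * ε ^ 2) := ⟨_, rfl⟩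
  have hκ2 : κ ^ 2 = 1 + m ^ 2 * ε ^ 2 := by rw [hκdef, Real.sq_sqrt (by positivity)]
  have hκ : 1 < κ := by rw [hκdef, Real.lt_sqrt (by norm_num)]; linarith
  have hκ0 : 0 < κ := by linarith
  rw [← hκdef] at hv ⊢
  obtain ⟨v, hvdef⟩ : ∃ v, v = max v₀ 0 := ⟨_, rfl⟩
  have hv0 : 0 ≤ v := hvdef ▸ le_max_right _ _
  have hv₀ : v₀ ≤ v := hvdef ▸ le_max_left _ _
  have hvκ : v * κ < 1 := by
    rw [← lt_div_iff₀ hκ0, hvdef]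
    exact max_lt hv (by positivity)
  have hv1 : v < 1 := by nlinarith
  obtain ⟨a, b, hab, hab', hfail⟩ := exists_sign_failure (l := (1 + v) / (1 - v)) hκ (by
    rw [div_lt_div_iff₀ (by linarith) (by linarith)]
    linarith)
  rw [div_mul_eq_mul_div, div_lt_iff₀ (by linarith)] at hab
  refine ⟨a - b, a + b + 1, ?_, ⟨a, by ring⟩, ?_, ?_, fun h => hfail ?_⟩
  · push_cast
    positivity
  · push_cast
    rw [mul_div_mul_right _ _ hε.ne', le_div_iff₀ (by positivity)]
    refine (mul_le_mul_of_nonneg_right hv₀ (by positivity)).trans ?_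
    linarith
  · push_cast
    rw [mul_div_mul_right _ _ hε.ne', div_lt_div_iff₀ (by positivity) hκ0]
    linarith
  · have hz : (1 - κ ^ 2) = -(m * ε) ^ 2 := by rw [hκ2]; ring
    have hexp : ((a : ℤ) + b + 1 - (a - b) - 1) / 2 = (b : ℤ) := by omega
    rw [hexp, zpow_natCast] at h
    push_cast at h
    rw [checkerWaveRe_eq hε, hz.symm] at h
    have hpos : 0 < (1 + m ^ 2 * ε ^ 2) ^ ((1 - (((a : ℝ) + b + 1) * ε + ε) / ε) / 2) :=
      Real.rpow_pos_of_pos (by positivity) _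
    have hme : 0 < m * ε := mul_pos hm hε
    suffices hT : 0 < (-1) ^ b * choosePairSum (1 - κ ^ 2) a b from ⟨hT.le, fun _ => hT⟩
    have hne : Real.sign ((1 + m ^ 2 * ε ^ 2) ^ ((1 - (((a : ℝ) + b + 1) * ε + ε) / ε) / 2)
        * (m * ε * choosePairSum (1 - κ ^ 2) a b)) ≠ 0 := h ▸ pow_ne_zero b (by norm_num)
    have hmul := Real.sign_mul_pos_of_ne_zero _ (mt Real.sign_eq_zero_iff.2 hne)
    rw [h] at hmul
    refine pos_of_mul_pos_right (a := (1 + m ^ 2 * ε ^ 2) ^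
      ((1 - (((a : ℝ) + b + 1) * ε + ε) / ε) / 2) * (m * ε)) ?_ (mul_pos hpos hme).le
    linarith

section Young

theorem finite_isYoungDiagramOfSize (w h : ℕ) (hh : 0 < h) :
    {s : Fin h → ℕ | IsYoungDiagramOfSize w h s}.Finite := by
  refine (Set.finite_Iic (fun _ : Fin h => w)).subset fun s hs i => ?_
  have h1 : s i ≤ s ⟨h - 1, by omega⟩ := hs.1 (Fin.mk_le_mk.2 (by omega))
  rwa [hs.2.2 ⟨h - 1, by omega⟩ (by simp; omega)] at h1

theorem isYoungDiagramOfSize_one (w : ℕ) (hw : 0 < w) :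
    {s : Fin 1 → ℕ | IsYoungDiagramOfSize w 1 s} = {fun _ => w} := by
  ext s
  simp only [IsYoungDiagramOfSize, Set.mem_ofPred_eq, Set.mem_singleton_iff]
  constructor
  · rintro ⟨_, _, h⟩
    funext i
    exact h i (by omega)
  · rintro rfl
    exact ⟨monotone_const, fun _ => hw, fun _ _ => rfl⟩

theorem isYoungDiagramOfSize_snoc {w h : ℕ} (s : Fin (h + 1) → ℕ) :
    IsYoungDiagramOfSize w (h + 2) (Fin.snoc (α := fun _ => ℕ) s w)
      ↔ IsYoungDiagramOfSize (s (Fin.last h)) (h + 1) s ∧ s (Fin.last h) ≤ w := by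
  have hlast : ∀ {n : ℕ} (i : Fin (n + 1)), (i : ℕ) + 1 = n + 1 → i = Fin.last n :=
    fun i hi => Fin.ext (by simpa using hi)
  constructor
  · rintro ⟨hm, hp, -⟩
    refine ⟨⟨fun i j hij => ?_, fun i => ?_, fun i hi => by rw [hlast i hi]⟩, ?_⟩
    · simpa using hm (Fin.castSucc_le_castSucc_iff.2 hij)
    · simpa using hp i.castSucc
    · simpa using hm (Fin.le_last (Fin.last h).castSucc)
  · rintro ⟨⟨hm, hp, -⟩, hw⟩
    have hle : ∀ i, s i ≤ w := fun i => (hm (Fin.le_last i)).trans hw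
    refine ⟨fun i j hij => ?_, fun i => ?_, fun i hi => by rw [hlast i hi, Fin.snoc_last]⟩
    · induction j using Fin.lastCases with
      | last =>
        induction i using Fin.lastCases with
        | last => exact le_rfl
        | cast i => simpa using hle i
      | cast j =>
        induction i using Fin.lastCases with
        | last => exact absurd hij (not_le.2 (Fin.castSucc_lt_last j))
        | cast i => simpa using hm (Fin.castSucc_le_castSucc_iff.1 hij)
    · induction i using Fin.lastCases with
      | last => simpa using (hp (Fin.last h)).trans_le hw
      | cast i => simpa using hp i

theorem youngSteps_snoc {v w h : ℕ} {s : Fin (h + 1) → ℕ} (hs : IsYoungDiagramOfSize v (h + 1) s)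
    (hw : v ≤ w) : youngSteps (Fin.snoc (α := fun _ => ℕ) s w)
      = youngSteps s + if v = w then 0 else 1 := by
  have himage : Finset.univ.image (Fin.snoc (α := fun _ => ℕ) s w : Fin (h + 2) → ℕ)
      = insert w (Finset.univ.image s) := by
    apply Finset.coe_injective
    simp only [Finset.coe_image, Finset.coe_univ, Set.image_univ, Finset.coe_insert]
    exact Fin.range_snoc s w
  have hv : s (Fin.last h) = v := hs.2.2 _ (by simp)
  have hmem : w ∈ Finset.univ.image s ↔ v = w := by
    constructor
    · intro h
      obtain ⟨i, -, hi⟩ := Finset.mem_image.1 h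
      exact le_antisymm hw (hi ▸ hv ▸ hs.1 (Fin.le_last i))
    · rintro rfl
      exact Finset.mem_image.2 ⟨Fin.last h, Finset.mem_univ _, hv⟩
  rw [youngSteps, youngSteps, himage, Finset.card_insert_eq_ite]
  simp only [hmem]
  split_ifs <;> rfl

/-- The number of diagrams with an odd number of steps minus that with an even number. -/
noncomputable def youngSignedCount (w h : ℕ) : ℤ :=
  ∑ᶠ s ∈ {s : Fin h → ℕ | IsYoungDiagramOfSize w h s}, (-1) ^ (youngSteps s + 1)

theorem isYoungDiagramOfSize_add_two (b h : ℕ) :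
    {s : Fin (h + 2) → ℕ | IsYoungDiagramOfSize (b + 1) (h + 2) s}
      = ⋃ j ∈ (Finset.range (b + 1) : Set ℕ), (fun s => Fin.snoc (α := fun _ => ℕ) s (b + 1)) ''
          {s : Fin (h + 1) → ℕ | IsYoungDiagramOfSize (j + 1) (h + 1) s} := by
  ext s
  simp only [Set.mem_ofPred_eq, Set.mem_iUnion, Set.mem_image, exists_prop, Finset.mem_coe,
    Finset.mem_range]
  constructor
  · intro hs
    have hlast : s (Fin.last (h + 1)) = b + 1 := hs.2.2 _ (by simp)
    have hsnoc : Fin.snoc (α := fun _ => ℕ) (Fin.init s) (b + 1) = s := by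
      rw [← hlast]
      exact Fin.snoc_init_self s
    rw [← hsnoc, isYoungDiagramOfSize_snoc] at hs
    have h0 := hs.1.2.1 (Fin.last h)
    refine ⟨Fin.init s (Fin.last h) - 1, by omega, Fin.init s, ?_, hsnoc⟩
    rw [Nat.sub_add_cancel h0]
    exact hs.1
  · rintro ⟨j, hj, s, hs, rfl⟩
    have hv : s (Fin.last h) = j + 1 := hs.2.2 _ (by simp)
    rw [isYoungDiagramOfSize_snoc, hv]
    exact ⟨hs, by omega⟩

theorem youngSignedCount_add_two (b h : ℕ) :
    youngSignedCount (b + 1) (h + 2) = youngSignedCount (b + 1) (h + 1)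
      - ∑ j ∈ Finset.range b, youngSignedCount (j + 1) (h + 1) := by
  have hinj : Function.Injective
      (fun s : Fin (h + 1) → ℕ => (Fin.snoc (α := fun _ => ℕ) s (b + 1) : Fin (h + 2) → ℕ)) :=
    Fin.snoc_left_injective (α := fun _ => ℕ) _
  rw [youngSignedCount, isYoungDiagramOfSize_add_two, finsum_mem_biUnion]
  · have hterm : ∀ j ∈ Finset.range (b + 1),
        ∑ᶠ s ∈ (fun s => Fin.snoc (α := fun _ => ℕ) s (b + 1)) ''
          {s : Fin (h + 1) → ℕ | IsYoungDiagramOfSize (j + 1) (h + 1) s},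
            (-1 : ℤ) ^ (youngSteps (s : Fin (h + 2) → ℕ) + 1)
          = (-1) ^ (if j = b then 0 else 1) * youngSignedCount (j + 1) (h + 1) := by
      intro j hj
      rw [finsum_mem_image hinj.injOn, youngSignedCount, ← smul_eq_mul,
        smul_finsum_mem (finite_isYoungDiagramOfSize _ _ h.succ_pos)]
      refine finsum_mem_congr rfl fun s hs => ?_
      rw [youngSteps_snoc hs (by simpa [Nat.lt_succ_iff] using hj), smul_eq_mul, ← pow_add]
      simp only [Nat.add_right_cancel_iff]
      congr 1
      ring
    rw [finsum_mem_coe_finset, Finset.sum_congr rfl hterm, Finset.sum_range_succ, add_comm,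
      sub_eq_add_neg, ← Finset.sum_neg_distrib]
    congr 1
    · simp
    · refine Finset.sum_congr rfl fun j hj => ?_
      rw [if_neg (Finset.mem_range.1 hj).ne]
      ring
  · intro i _ j _ hij
    rw [Function.onFun, Set.disjoint_left]
    rintro _ ⟨s, hs, rfl⟩ ⟨s', hs', heq⟩
    obtain rfl := hinj heq
    have h1 := hs.2.2 (Fin.last h) (by simp)
    have h2 := hs'.2.2 (Fin.last h) (by simp)
    omega
  · exact Finset.finite_toSet _
  · exact fun j _ => (finite_isYoungDiagramOfSize _ _ h.succ_pos).image _

theorem youngSignedCount_eq (a b : ℕ) :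
    youngSignedCount (b + 1) (a + 1) = choosePairSum (-1) a b := by
  induction a generalizing b with
  | zero =>
    rw [youngSignedCount]
    rw [isYoungDiagramOfSize_one _ b.succ_pos]
    simp [youngSteps]
  | succ a ih =>
    rw [youngSignedCount_add_two, choosePairSum_succ_left, choosePairShift_eq_sum, ih,
      Finset.sum_congr rfl fun j _ => ih j]
    ring

theorem youngOddCount_sub_youngEvenCount (a b : ℕ) :
    (youngOddCount (b + 1) (a + 1) : ℤ) - youngEvenCount (b + 1) (a + 1)
      = choosePairSum (-1) a b := by
  classical
  have hfin := finite_isYoungDiagramOfSize (b + 1) (a + 1) a.succ_pos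
  have hodd : youngOddCount (b + 1) (a + 1)
      = (hfin.toFinset.filter fun s => Odd (youngSteps s)).card := by
    rw [youngOddCount, ← Set.ncard_coe_finset]
    simp
  have heven : youngEvenCount (b + 1) (a + 1)
      = (hfin.toFinset.filter fun s => Even (youngSteps s)).card := by
    rw [youngEvenCount, ← Set.ncard_coe_finset]
    simp
  rw [← youngSignedCount_eq, youngSignedCount, finsum_mem_eq_finite_toFinset_sum _ hfin, hodd,
    heven, Finset.card_filter, Finset.card_filter]
  push_cast
  rw [← Finset.sum_sub_distrib]
  refine Finset.sum_congr rfl fun s _ => ?_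
  rcases Nat.even_or_odd (youngSteps s) with h | h
  · rw [if_neg (Nat.not_odd_iff_even.2 h), if_pos h, pow_succ, h.neg_one_pow]
    norm_num
  · rw [if_pos h, if_neg (Nat.not_even_iff_odd.2 h), pow_succ, h.neg_one_pow]
    norm_num

theorem exists_young_parity_failure {c : ℝ} (hc : c < 3 + 2 * Real.sqrt 2) :
    ∃ w h : ℕ, 0 < w ∧ 0 < h ∧ c < (h : ℝ) / (w : ℝ) ∧
      (h : ℝ) / (w : ℝ) < 3 + 2 * Real.sqrt 2 ∧
      ¬ (youngEvenCount w h < youngOddCount w h ↔ Odd w) := by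
  obtain ⟨κ, hκ⟩ : ∃ κ, κ = Real.sqrt 2 := ⟨_, rfl⟩
  have hκ2 : κ ^ 2 = 2 := by rw [hκ, Real.sq_sqrt (by norm_num)]
  have hκ1 : 1 < κ := by rw [hκ, Real.lt_sqrt (by norm_num)]; norm_num
  rw [← hκ] at hc ⊢
  obtain ⟨a, b, hab, hab', hfail⟩ := exists_sign_failure (l := c) hκ1 (by
    rw [lt_div_iff₀ (by linarith)]
    nlinarith)
  refine ⟨b + 1, a + 1, b.succ_pos, a.succ_pos, ?_, ?_, fun h => hfail ?_⟩
  · rw [lt_div_iff₀ (by positivity)]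
    push_cast
    linarith
  · rw [div_lt_iff₀ (by positivity)]
    push_cast
    have := mul_le_mul_of_nonneg_right hab' (show 0 ≤ κ + 1 by linarith)
    nlinarith
  · have hz : (1 : ℝ) - κ ^ 2 = ((-1 : ℤ) : ℝ) := by rw [hκ2]; norm_num
    have hcast : choosePairSum (1 - κ ^ 2) a b = ((choosePairSum (-1 : ℤ) a b : ℤ) : ℝ) := by
      rw [hz]
      simp [choosePairSum]
    rw [hcast]
    have hsub := youngOddCount_sub_youngEvenCount a b
    rcases Nat.even_or_odd b with hb | hb
    · have h1 : 0 < choosePairSum (-1 : ℤ) a b := by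
        have := h.2 hb.add_one
        omega
      rw [hb.neg_one_pow, one_mul]
      have h2 : (0 : ℝ) < (choosePairSum (-1 : ℤ) a b : ℤ) := by exact_mod_cast h1
      exact ⟨h2.le, fun _ => h2⟩
    · have h1 : choosePairSum (-1 : ℤ) a b ≤ 0 := by
        have := mt h.1 (Nat.not_odd_iff_even.2 hb.add_one)
        omega
      rw [hb.neg_one_pow]
      have h2 : ((choosePairSum (-1 : ℤ) a b : ℤ) : ℝ) ≤ 0 := by exact_mod_cast h1
      exact ⟨by linarith, fun he => absurd he (Nat.not_even_iff_odd.2 hb)⟩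

end Young

/-- Lattice points are written `(x, t) = (p ε, q ε)`. For `p + q` odd, the integer quotient
`(q - p - 1) / 2` is exact and equals `(t - x - ε) / (2 ε)`. -/
theorem mainTheorem6 :
    -- the sign rule for the real part fails arbitrarily close below the bound, ...
    (∀ m ε : ℝ, 0 < m → 0 < ε → ε ≤ 1 / m →
      ∀ v₀ : ℝ, v₀ < 1 / Real.sqrt (1 + m ^ 2 * ε ^ 2) →
        ∃ p q : ℤ, 0 < (q : ℝ) * ε ∧ Odd (p + q) ∧
          v₀ ≤ ((p : ℝ) * ε) / ((q : ℝ) * ε) ∧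
          ((p : ℝ) * ε) / ((q : ℝ) * ε) < 1 / Real.sqrt (1 + m ^ 2 * ε ^ 2) ∧
          Real.sign (checkerWaveRe ((p : ℝ) * ε) ((q : ℝ) * ε) m ε)
            ≠ (-1 : ℝ) ^ ((q - p - 1) / 2)) ∧
    (∀ m ε : ℝ, 0 < m → 0 < ε → ε ≤ 1 / m →
      ∀ v₀ : ℝ, v₀ < 1 / Real.sqrt (1 + m ^ 2 * ε ^ 2) →
        ¬ ∀ p q : ℤ, 0 < (q : ℝ) * ε → Odd (p + q) →
          v₀ ≤ ((p : ℝ) * ε) / ((q : ℝ) * ε) → ((p : ℝ) * ε) / ((q : ℝ) * ε) ≤ 1 →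
          Real.sign (checkerWaveRe ((p : ℝ) * ε) ((q : ℝ) * ε) m ε)
            = (-1 : ℝ) ^ ((q - p - 1) / 2)) ∧
    -- ... and neither can `3 + 2 √2` in the parity rule for Young diagrams.
    (∀ c : ℝ, c < 3 + 2 * Real.sqrt 2 →
      ∃ w h : ℕ, 0 < w ∧ 0 < h ∧ c < (h : ℝ) / (w : ℝ) ∧
        (h : ℝ) / (w : ℝ) < 3 + 2 * Real.sqrt 2 ∧
        ¬ (youngEvenCount w h < youngOddCount w h ↔ Odd w)) := by
  refine ⟨fun m ε hm hε _ v₀ hv => exists_checkerWaveRe_sign_failure hm hε hv,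
    fun m ε hm hε _ v₀ hv hrule => ?_, fun c hc => exists_young_parity_failure hc⟩
  obtain ⟨p, q, hq, hodd, hle, hlt, hne⟩ := exists_checkerWaveRe_sign_failure hm hε hv
  refine hne (hrule p q hq hodd hle (hlt.le.trans ?_))
  rw [div_le_one (Real.sqrt_pos.2 (by positivity)), Real.one_le_sqrt]
  linarith [show 0 ≤ m ^ 2 * ε ^ 2 by positivity]
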